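/- Let $\sigma$ denote the shift $(\sigma x)_n = x_{n+1}$ on $A^{\mathbb Z}$, where $A$ is a finite discrete alphabet and $A^{\mathbb Z}$ has the product topology. A substitution of constant length $r\ge 2$ is a map $\theta : A\to A^r$, where $A$ is a finite alphabet with at least two letters; it induces $\overline\theta : A^{\mathbb Z}\to A^{\mathbb Z}$, where for every $n \in \mathbb Z$ the block of $\overline\theta(x)$ at the places $nr,\dots,nr+r-1$ is $\theta(x_n)$. A substitution minimal set generated by $\theta$ is a set $Y = \overline{\{\sigma^n x : n\in\mathbb Z\}}$, with $x$ a periodic point of $\overline\theta$, that is minimal for $\sigma$. The substitution $\theta$ is primitive if there is $K\ge 1$ such that for all $a,b\in A$ there is a directed path of length $K$ from $a$ to $b$ in the directed graph on $A$ that has an arc from $c$ to $d$ whenever $d$ appears in $\theta(c)$. The Toeplitz minimal set $T\subset\{0,1\}^{\mathbb Z}$ is the shift orbit closure of the unique point $t$ with $\overline\tau^2(t)=t$ and $t_{-1}=t_0=0$, where $\tau(0)=01$, $\tau(1)=00$. **Theorem.** Let $\theta$ be a one-to-one (as a map $A\to A^r$), primitive substitution of constant length $r \ge 2$ on an alphabet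 $A$ with at least two letters, and let $Y$ be a substitution minimal set generated by $\theta$. If $(Y,\sigma)$ is topologically conjugate to $(T,\sigma)$, then (a) the length $r$ of $\theta$ is a power of $2$, and (b) the alphabet $A$ has at most three letters. -/

import Mathlib

/-- The shift `σ` on bilaterally infinite sequences: `(σ x)_n = x_{n+1}`. -/
def shift {A : Type*} (x : ℤ → A) : ℤ → A := fun n => x (n + 1)

/-- The shift orbit closure `cl {σ^n x : n ∈ ℤ}`, in the product topology
(alphabets carry the discrete topology wherever this is used). -/
def orbitClosure {A : Type*} [TopologicalSpace A] (x : ℤ → A) : Set (ℤ → A) :=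
  closure (Set.range fun n : ℤ => fun k : ℤ => x (k + n))

/-- `Y` is a minimal set of the shift: nonempty, closed, shift-invariant, and without a proper
subset of this kind. -/
def IsShiftMinimal {A : Type*} [TopologicalSpace A] (Y : Set (ℤ → A)) : Prop :=
  Y.Nonempty ∧ IsClosed Y ∧ shift '' Y = Y ∧
    ∀ Z ⊆ Y, Z.Nonempty → IsClosed Z → shift '' Z = Z → Z = Y

/-- A substitution of constant length `r` on the alphabet `A` is a map `θ : A → A^r`. This is the
map it induces on bilaterally infinite sequences: the block of the image at the places
`nr, …, nr + r - 1` is `θ (x_n)`. (`/` and `%` are floor division and its remainder.) -/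
def substMap {A : Type*} {r : ℕ} [NeZero r] (θ : A → Fin r → A) (x : ℤ → A) : ℤ → A :=
  fun m => θ (x (m / r)) (Fin.ofNat r (m % r).toNat)

theorem substMap_apply {A : Type*} {r : ℕ} [NeZero r] (θ : A → Fin r → A) (x : ℤ → A)
    (n : ℤ) (j : Fin r) : substMap θ x (n * r + (j : ℕ)) = θ (x n) j := by
  have hr : (0 : ℤ) < r := by exact_mod_cast Nat.pos_of_ne_zero (NeZero.ne r)
  have hj : ((j : ℕ) : ℤ) < r := by exact_mod_cast j.2
  have h1 : (n * r + (j : ℕ)) / (r : ℤ) = n := by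
    rw [Int.add_comm, Int.add_mul_ediv_right _ _ hr.ne', Int.ediv_eq_zero_of_lt (by positivity) hj, zero_add]
  have h2 : (n * r + (j : ℕ)) % (r : ℤ) = (j : ℕ) := by
    rw [Int.mul_add_emod_self_right, Int.emod_eq_of_lt (by positivity) hj]
  unfold substMap
  rw [h1, h2]
  congr 1
  ext
  simp

/-- The arcs of the directed graph `G(θ)`: there is an arc from `a` to `b` if `b` appears
in `θ a`. -/
def SubstArc {A : Type*} {r : ℕ} (θ : A → Fin r → A) (a b : A) : Prop :=
  ∃ j, θ a j = b

/-- `θ` is primitive: for some `K ≥ 1`, any two letters are joined, in either direction, by a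
directed path of length `K` in `G(θ)` (vertices may repeat). -/
def IsPrimitiveSubst {A : Type*} {r : ℕ} (θ : A → Fin r → A) : Prop :=
  ∃ K : ℕ, 1 ≤ K ∧ ∀ a b : A, ∃ p : ℕ → A, p 0 = a ∧ p K = b ∧
    ∀ i < K, SubstArc θ (p i) (p (i + 1))

/-- `Y` is a substitution minimal set generated by `θ`: the orbit closure of a periodic point of
the induced map, and minimal. -/
def IsSubstMinimalSet {A : Type*} [TopologicalSpace A] {r : ℕ} [NeZero r] (θ : A → Fin r → A)
    (Y : Set (ℤ → A)) : Prop :=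
  ∃ x ∈ Function.periodicPts (substMap θ), Y = orbitClosure x ∧ IsShiftMinimal Y

/-- `(X, σ)` and `(Y, σ)` are topologically conjugate: both sets are shift-invariant and some
homeomorphism of `X` onto `Y` intertwines the restricted shifts. -/
def TopConjugate {A B : Type*} [TopologicalSpace A] [TopologicalSpace B]
    (X : Set (ℤ → A)) (Y : Set (ℤ → B)) : Prop :=
  ∃ (hX : Set.MapsTo shift X X) (hY : Set.MapsTo shift Y Y) (h : X ≃ₜ Y),
    Function.Semiconj h (hX.restrict shift X X) (hY.restrict shift Y Y)

/-- The Toeplitz substitution `0 ↦ 01`, `1 ↦ 00`. -/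
def toeplitzSubst : Fin 2 → Fin 2 → Fin 2 := ![![0, 1], ![0, 0]]

/-- The point `t_{0.0}`: its entry at `n` is the parity of the 2-adic valuation of `n + 1`, and
`0` at `n = -1`. It is characterized in `eq_toeplitzSeq_iff`. -/
def toeplitzSeq (n : ℤ) : Fin 2 := if Odd (padicValInt 2 (n + 1)) then 1 else 0

/-- The Toeplitz minimal set. -/
def toeplitzSet : Set (ℤ → Fin 2) := orbitClosure toeplitzSeq

theorem substMap_toeplitz_even (x : ℤ → Fin 2) (n : ℤ) : substMap toeplitzSubst x (2 * n) = 0 := by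
  have h := substMap_apply toeplitzSubst x n 0
  have e : n * ((2 : ℕ) : ℤ) + ((0 : Fin 2) : ℕ) = 2 * n := by simp; ring
  rw [e] at h
  rw [h]
  generalize x n = a
  revert a
  decide

theorem substMap_toeplitz_odd (x : ℤ → Fin 2) (n : ℤ) :
    substMap toeplitzSubst x (2 * n + 1) = 1 - x n := by
  have h := substMap_apply toeplitzSubst x n 1
  have e : n * ((2 : ℕ) : ℤ) + ((1 : Fin 2) : ℕ) = 2 * n + 1 := by simp; ring
  rw [e] at h
  rw [h]
  generalize x n = a
  revert a
  decide

theorem toeplitzSeq_even (n : ℤ) : toeplitzSeq (2 * n) = 0 := by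
  have h : padicValInt 2 (2 * n + 1) = 0 := padicValInt.eq_zero_of_not_dvd (by omega)
  simp [toeplitzSeq, h]

theorem toeplitzSeq_odd (n : ℤ) (hn : n ≠ -1) : toeplitzSeq (2 * n + 1) = 1 - toeplitzSeq n := by
  have h : padicValInt 2 (2 * n + 1 + 1) = 1 + padicValInt 2 (n + 1) := by
    have e : 2 * n + 1 + 1 = ((2 : ℕ) : ℤ) * (n + 1) := by push_cast; ring
    have : Fact (Nat.Prime 2) := ⟨Nat.prime_two⟩
    rw [e, padicValInt.mul (by norm_num) (by omega), padicValInt.self (by norm_num)]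
  unfold toeplitzSeq
  rw [h]
  by_cases ho : Odd (padicValInt 2 (n + 1))
  · have : ¬ Odd (1 + padicValInt 2 (n + 1)) := by
      rw [Nat.not_odd_iff_even]; exact odd_one.add_odd ho
    simp [ho, this]
  · have : Odd (1 + padicValInt 2 (n + 1)) := odd_one.add_even (Nat.not_odd_iff_even.mp ho)
    simp [ho, this]

/-- `toeplitzSeq` is the unique fixed point `x` of the square of the map induced by the Toeplitz
substitution that has `x_{-1} = 0` and `x_0 = 0`. -/
theorem eq_toeplitzSeq_iff (x : ℤ → Fin 2) :
    x = toeplitzSeq ↔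
      substMap toeplitzSubst (substMap toeplitzSubst x) = x ∧ x (-1) = 0 ∧ x 0 = 0 := by
  have c : ∀ a : Fin 2, 1 - (1 - a) = a := by decide
  have ht : toeplitzSeq (-1) = 0 := by simp [toeplitzSeq]
  constructor
  · rintro rfl
    refine ⟨?_, ht, toeplitzSeq_even 0⟩
    funext m
    rcases Int.even_or_odd' m with ⟨n, rfl | rfl⟩
    · rw [substMap_toeplitz_even, toeplitzSeq_even]
    · rw [substMap_toeplitz_odd]
      by_cases hn : n = -1
      · subst hn
        have := substMap_toeplitz_odd toeplitzSeq (-1)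
        norm_num at this ⊢
        rw [this, ht]
        decide
      · rw [toeplitzSeq_odd n hn]
        congr 1
        rcases Int.even_or_odd' n with ⟨k, rfl | rfl⟩
        · rw [substMap_toeplitz_even, toeplitzSeq_even]
        · rw [substMap_toeplitz_odd, toeplitzSeq_odd k (by omega)]
  · rintro ⟨hx, h1, h0⟩
    have key : ∀ N : ℕ, ∀ m : ℤ, m.natAbs ≤ N → x m = toeplitzSeq m := by
      intro N
      induction N with
      | zero =>
        intro m hm
        obtain rfl : m = 0 := by omega
        rw [h0]; exact (toeplitzSeq_even 0).symm
      | succ N ih =>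
        intro m hm
        by_cases hm1 : m = -1
        · rw [hm1, h1, ht]
        rw [← hx]
        rcases Int.even_or_odd' m with ⟨n, rfl | rfl⟩
        · rw [substMap_toeplitz_even, toeplitzSeq_even]
        · rw [substMap_toeplitz_odd, toeplitzSeq_odd n (by omega)]
          congr 1
          rcases Int.even_or_odd' n with ⟨k, rfl | rfl⟩
          · rw [substMap_toeplitz_even, toeplitzSeq_even]
          · rw [substMap_toeplitz_odd, toeplitzSeq_odd k (by omega), ih k (by omega)]
    funext m
    exact key _ m le_rfl

/-! ### Shifts and orbit closures. -/

/-- The shift by `n` places. -/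
def shiftBy {A : Type*} (n : ℤ) (x : ℤ → A) : ℤ → A := fun k => x (k + n)

theorem shiftBy_shiftBy {A : Type*} (m n : ℤ) (x : ℤ → A) :
    shiftBy m (shiftBy n x) = shiftBy (m + n) x := by
  funext k
  simp only [shiftBy]
  congr 1
  ring

theorem shiftBy_zero {A : Type*} (x : ℤ → A) : shiftBy 0 x = x := by
  funext k
  simp [shiftBy]

theorem continuous_shiftBy {A : Type*} [TopologicalSpace A] (n : ℤ) :
    Continuous (shiftBy n : (ℤ → A) → ℤ → A) :=
  continuous_pi fun k => continuous_apply (k + n)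

theorem self_mem_orbitClosure {A : Type*} [TopologicalSpace A] (x : ℤ → A) :
    x ∈ orbitClosure x :=
  subset_closure ⟨0, by simp⟩

theorem shiftBy_mem_orbitClosure {A : Type*} [TopologicalSpace A] {x y : ℤ → A} (n : ℤ)
    (hy : y ∈ orbitClosure x) : shiftBy n y ∈ orbitClosure x := by
  refine map_mem_closure (continuous_shiftBy n) hy ?_
  rintro _ ⟨m, rfl⟩
  exact ⟨n + m, by funext k; simp only [shiftBy]; congr 1; ring⟩

/-! ### Cylinders and block codes. -/

section Cylinders

variable {A : Type*} [TopologicalSpace A]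

/-- Every neighbourhood of a sequence contains a central cylinder. -/
theorem exists_cylinder_subset {x : ℤ → A} {U : Set (ℤ → A)} (hU : U ∈ nhds x) :
    ∃ M : ℕ, ∀ y : ℤ → A, (∀ k : ℤ, |k| ≤ M → y k = x k) → y ∈ U := by
  obtain ⟨V, hVU, hV, hxV⟩ := mem_nhds_iff.mp hU
  obtain ⟨I, u, hu, hIV⟩ := isOpen_pi_iff.mp hV x hxV
  refine ⟨I.sup Int.natAbs, fun y hy => hVU (hIV fun k hk => ?_)⟩
  have hk' : k.natAbs ≤ I.sup Int.natAbs := Finset.le_sup (f := Int.natAbs) hk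
  rw [hy k (by rw [Int.abs_eq_natAbs]; exact_mod_cast hk')]
  exact (hu k hk).2

theorem mem_of_forall_cylinder {x : ℤ → A} {Z : Set (ℤ → A)} (hZ : IsClosed Z)
    (h : ∀ M : ℕ, ∃ z ∈ Z, ∀ k : ℤ, |k| ≤ M → z k = x k) : x ∈ Z := by
  rw [← hZ.closure_eq, mem_closure_iff_nhds]
  intro U hU
  obtain ⟨M, hM⟩ := exists_cylinder_subset hU
  obtain ⟨z, hz, hzx⟩ := h M
  exact ⟨z, hM z hzx, hz⟩

variable [DiscreteTopology A]

theorem isOpen_cylinder (x : ℤ → A) (M : ℕ) :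
    IsOpen {y : ℤ → A | ∀ k : ℤ, |k| ≤ M → y k = x k} := by
  have : {y : ℤ → A | ∀ k : ℤ, |k| ≤ M → y k = x k} =
      (Set.Icc (-(M : ℤ)) M).pi fun k => {x k} := by
    ext y
    simp [Set.mem_pi, abs_le]
  rw [this]
  exact isOpen_set_pi (Set.finite_Icc _ _) fun k _ => isOpen_discrete _

/-- A continuous shift-equivariant map between subshifts over finite alphabets is a block code. -/
theorem exists_radius [Finite A] {B : Type*} [TopologicalSpace B] [DiscreteTopology B]
    {X : Set (ℤ → A)} (hX : IsClosed X) (hshift : ∀ n : ℤ, ∀ x ∈ X, shiftBy n x ∈ X)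
    {f : (ℤ → A) → ℤ → B} (hf : ContinuousOn f X)
    (hequiv : ∀ n : ℤ, ∀ x ∈ X, f (shiftBy n x) = shiftBy n (f x)) :
    ∃ R : ℕ, ∀ x ∈ X, ∀ y ∈ X, ∀ i : ℤ, (∀ k : ℤ, |k - i| ≤ R → x k = y k) → f x i = f y i := by
  have hloc : ∀ x ∈ X, ∃ M : ℕ, ∀ y ∈ X, (∀ k : ℤ, |k| ≤ M → y k = x k) → f y 0 = f x 0 := by
    intro x hx
    have h1 : {z : ℤ → B | z 0 = f x 0} ∈ nhds (f x) :=
      ((isOpen_discrete {f x 0}).preimage (continuous_apply (0 : ℤ))).mem_nhds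
        (Set.mem_singleton _)
    have h2 := hf x hx h1
    obtain ⟨U, hU, hUX⟩ := mem_nhdsWithin_iff_exists_mem_nhds_inter.mp h2
    obtain ⟨M, hM⟩ := exists_cylinder_subset hU
    exact ⟨M, fun y hy hyx => hUX ⟨hM y hyx, hy⟩⟩
  choose! M hM using hloc
  obtain ⟨s, hsX, hs⟩ := hX.isCompact.elim_nhds_subcover
    (fun x => {y : ℤ → A | ∀ k : ℤ, |k| ≤ M x → y k = x k})
    (fun x _ => (isOpen_cylinder x (M x)).mem_nhds fun _ _ => rfl)
  have hzero : ∀ x ∈ X, ∀ y ∈ X, (∀ k : ℤ, |k| ≤ s.sup M → x k = y k) → f x 0 = f y 0 := by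
    intro x hx y hy hxy
    obtain ⟨c, hc, hxc⟩ := Set.mem_iUnion₂.mp (hs hx)
    have hcs : M c ≤ s.sup M := Finset.le_sup hc
    rw [hM c (hsX c hc) x hx hxc, hM c (hsX c hc) y hy]
    intro k hk
    rw [← hxy k (by omega)]
    exact hxc k hk
  refine ⟨s.sup M, fun x hx y hy i hxy => ?_⟩
  have := hzero (shiftBy i x) (hshift i x hx) (shiftBy i y) (hshift i y hy)
    (fun k hk => hxy (k + i) (by simpa using hk))
  rw [hequiv i x hx, hequiv i y hy] at this
  simpa [shiftBy] using this

end Cylinders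

/-- Mutually inverse block codes of radius `R` between two shift-invariant sets. -/
structure BlockConjugacy {A B : Type*} [TopologicalSpace A] [TopologicalSpace B]
    (X : Set (ℤ → A)) (Y : Set (ℤ → B)) (f : (ℤ → A) → ℤ → B) (g : (ℤ → B) → ℤ → A)
    (R : ℕ) : Prop where
  mapsTo : ∀ x ∈ X, f x ∈ Y
  mapsTo_inv : ∀ y ∈ Y, g y ∈ X
  left_inv : ∀ x ∈ X, g (f x) = x
  right_inv : ∀ y ∈ Y, f (g y) = y
  continuousOn : ContinuousOn f X
  equivariant : ∀ n : ℤ, ∀ x ∈ X, f (shiftBy n x) = shiftBy n (f x)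
  equivariant_inv : ∀ n : ℤ, ∀ y ∈ Y, g (shiftBy n y) = shiftBy n (g y)
  local_code : ∀ x ∈ X, ∀ y ∈ X, ∀ i : ℤ, (∀ k : ℤ, |k - i| ≤ R → x k = y k) → f x i = f y i
  local_inv : ∀ x ∈ Y, ∀ y ∈ Y, ∀ i : ℤ, (∀ k : ℤ, |k - i| ≤ R → x k = y k) → g x i = g y i

theorem TopConjugate.exists_blockConjugacy {A B : Type*} [Finite A] [Finite B] [Nonempty A]
    [Nonempty B] [TopologicalSpace A]
    [TopologicalSpace B] [DiscreteTopology A] [DiscreteTopology B] {X : Set (ℤ → A)}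
    {Y : Set (ℤ → B)} (hX : IsClosed X) (hY : IsClosed Y)
    (hXs : ∀ n : ℤ, ∀ x ∈ X, shiftBy n x ∈ X) (hYs : ∀ n : ℤ, ∀ y ∈ Y, shiftBy n y ∈ Y)
    (h : TopConjugate X Y) : ∃ f g R, BlockConjugacy X Y f g R := by
  classical
  obtain ⟨_, _, e, he⟩ := h
  -- The values off `X` and `Y` are arbitrary; every property below is claimed only on these sets.
  let f : (ℤ → A) → ℤ → B := fun x =>
    if hx : x ∈ X then (e ⟨x, hx⟩ : ℤ → B) else Classical.arbitrary _
  let g : (ℤ → B) → ℤ → A := fun y =>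
    if hy : y ∈ Y then (e.symm ⟨y, hy⟩ : ℤ → A) else Classical.arbitrary _
  have hf : ∀ x (hx : x ∈ X), f x = e ⟨x, hx⟩ := fun x hx => dif_pos hx
  have hg : ∀ y (hy : y ∈ Y), g y = e.symm ⟨y, hy⟩ := fun y hy => dif_pos hy
  have hfm : ∀ x ∈ X, f x ∈ Y := fun x hx => by rw [hf x hx]; exact (e ⟨x, hx⟩).2
  have hgm : ∀ y ∈ Y, g y ∈ X := fun y hy => by rw [hg y hy]; exact (e.symm ⟨y, hy⟩).2
  have hgf : ∀ x ∈ X, g (f x) = x := by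
    intro x hx
    rw [hg _ (hfm x hx)]
    simp only [hf x hx, Subtype.coe_eta, Homeomorph.symm_apply_apply]
  have hfg : ∀ y ∈ Y, f (g y) = y := by
    intro y hy
    rw [hf _ (hgm y hy)]
    simp only [hg y hy, Subtype.coe_eta, Homeomorph.apply_symm_apply]
  have hfc : ContinuousOn f X := by
    rw [continuousOn_iff_continuous_domRestrict]
    have : X.domRestrict f = fun x => (e x : ℤ → B) := by
      funext x
      exact hf x x.2
    rw [this]
    exact continuous_subtype_val.comp e.continuous
  have hgc : ContinuousOn g Y := by
    rw [continuousOn_iff_continuous_domRestrict]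
    have : Y.domRestrict g = fun y => (e.symm y : ℤ → A) := by
      funext y
      exact hg y y.2
    rw [this]
    exact continuous_subtype_val.comp e.symm.continuous
  have hone : ∀ x ∈ X, f (shiftBy 1 x) = shiftBy 1 (f x) := by
    intro x hx
    rw [hf _ (hXs 1 x hx), hf x hx]
    exact congrArg Subtype.val (he ⟨x, hx⟩)
  have hnat : ∀ n : ℕ, ∀ x ∈ X, f (shiftBy n x) = shiftBy n (f x) := by
    intro n
    induction n with
    | zero => intro x _; simp [shiftBy_zero]
    | succ n ih =>
      intro x hx
      have := hone _ (hXs n x hx)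
      rw [ih x hx, shiftBy_shiftBy, shiftBy_shiftBy] at this
      rw [Nat.cast_succ, add_comm]
      exact this
  have hfe : ∀ n : ℤ, ∀ x ∈ X, f (shiftBy n x) = shiftBy n (f x) := by
    intro n x hx
    obtain ⟨k, rfl | rfl⟩ := n.eq_nat_or_neg
    · exact hnat k x hx
    · have := hnat k _ (hXs (-k) x hx)
      rw [shiftBy_shiftBy, add_neg_cancel, shiftBy_zero] at this
      rw [this, shiftBy_shiftBy, neg_add_cancel, shiftBy_zero]
  have hge : ∀ n : ℤ, ∀ y ∈ Y, g (shiftBy n y) = shiftBy n (g y) := by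
    intro n y hy
    have := hfe n (g y) (hgm y hy)
    rw [hfg y hy] at this
    rw [← this, hgf _ (hXs n _ (hgm y hy))]
  obtain ⟨R, hR⟩ := exists_radius hX hXs hfc hfe
  obtain ⟨S, hS⟩ := exists_radius hY hYs hgc hge
  refine ⟨f, g, max R S, hfm, hgm, hgf, hfg, hfc, hfe, hge, ?_, ?_⟩
  · exact fun x hx y hy i h => hR x hx y hy i fun k hk => h k (by push_cast; omega)
  · exact fun x hx y hy i h => hS x hx y hy i fun k hk => h k (by push_cast; omega)

/-! ### Asymptotic pairs and the action of a substitution. -/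

/-- Two sequences are asymptotic if they agree outside a finite window. -/
def Asymptotic {A : Type*} (x y : ℤ → A) : Prop :=
  ∃ M : ℕ, ∀ k : ℤ, M < |k| → x k = y k

theorem Asymptotic.map_local {A B : Type*} {X : Set (ℤ → A)} {f : (ℤ → A) → ℤ → B} {R : ℕ}
    (hf : ∀ x ∈ X, ∀ y ∈ X, ∀ i : ℤ, (∀ k : ℤ, |k - i| ≤ R → x k = y k) → f x i = f y i)
    {x y : ℤ → A} (hx : x ∈ X) (hy : y ∈ X) (h : Asymptotic x y) : Asymptotic (f x) (f y) := by
  obtain ⟨M, hM⟩ := h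
  refine ⟨M + R, fun i hi => hf x hx y hy i fun k hk => hM k ?_⟩
  push_cast at hi
  have := abs_sub_abs_le_abs_sub i k
  rw [abs_sub_comm] at this
  linarith

section Substitution

variable {A : Type*} {r : ℕ} [NeZero r] {θ : A → Fin r → A}

theorem natCast_pos_of_neZero (r : ℕ) [NeZero r] : (0 : ℤ) < r := by
  exact_mod_cast Nat.pos_of_ne_zero (NeZero.ne r)

theorem substMap_shiftBy (θ : A → Fin r → A) (n : ℤ) (x : ℤ → A) :
    substMap θ (shiftBy n x) = shiftBy (r * n) (substMap θ x) := by
  have hr := natCast_pos_of_neZero r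
  funext k
  simp only [substMap, shiftBy]
  rw [Int.add_mul_ediv_left _ _ hr.ne', Int.add_mul_emod_self_left]

theorem iterate_substMap_shiftBy (θ : A → Fin r → A) (p : ℕ) (n : ℤ) (x : ℤ → A) :
    (substMap θ)^[p] (shiftBy n x) = shiftBy ((r : ℤ) ^ p * n) ((substMap θ)^[p] x) := by
  induction p generalizing n x with
  | zero => simp
  | succ p ih =>
    rw [Function.iterate_succ_apply, substMap_shiftBy, ih, Function.iterate_succ_apply, pow_succ,
      mul_assoc]

theorem continuous_substMap [TopologicalSpace A] [DiscreteTopology A] (θ : A → Fin r → A) :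
    Continuous (substMap θ) := by
  refine continuous_pi fun m => ?_
  exact (continuous_of_discreteTopology
    (f := fun a : A => θ a (Fin.ofNat r (m % r).toNat))).comp (continuous_apply (m / (r : ℤ)))

/-- The letter at place `n` is determined by the block of the image at `nr, …, nr + r - 1`. -/
theorem eq_of_substMap_block_eq (hθ : Function.Injective θ) {x y : ℤ → A} {n : ℤ}
    (h : ∀ k : ℤ, n * r ≤ k → k < n * r + r → substMap θ x k = substMap θ y k) : x n = y n := by
  refine hθ (funext fun j => ?_)
  have hj : ((j : ℕ) : ℤ) < r := by exact_mod_cast j.2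
  rw [← substMap_apply θ x, ← substMap_apply θ y]
  exact h _ (by omega) (by omega)

theorem substMap_injective (hθ : Function.Injective θ) : Function.Injective (substMap θ) :=
  fun _ _ h => funext fun _ => eq_of_substMap_block_eq hθ fun _ _ _ => by rw [h]

/-- Injectivity of `θ` lets a block of length `r ^ (p + 1)` be decoded to one of length `r ^ p`, and
so on down to a single letter. -/
theorem eq_of_iterate_substMap_block_eq (hθ : Function.Injective θ) (p : ℕ) {x y : ℤ → A}
    (h : ∀ k : ℤ, 0 ≤ k → k < (r : ℤ) ^ p → (substMap θ)^[p] x k = (substMap θ)^[p] y k) :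
    x 0 = y 0 := by
  induction p with
  | zero => exact h 0 le_rfl (by simp)
  | succ p ih =>
    refine ih fun n hn hnr => eq_of_substMap_block_eq hθ fun k hk hkr => ?_
    have hr := natCast_pos_of_neZero r
    rw [← Function.iterate_succ_apply' (substMap θ), ← Function.iterate_succ_apply' (substMap θ)]
    refine h k (le_trans (by positivity) hk) ?_
    rw [pow_succ]
    nlinarith

theorem Asymptotic.substMap {x y : ℤ → A} (h : Asymptotic x y) :
    Asymptotic (substMap θ x) (_root_.substMap θ y) := by
  obtain ⟨M, hM⟩ := h
  have hr := natCast_pos_of_neZero r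
  refine ⟨(M + 1) * r, fun k hk => ?_⟩
  unfold _root_.substMap
  rw [hM]
  push_cast at hk
  have h1 := Int.ediv_mul_le k hr.ne'
  have h2 := Int.lt_ediv_add_one_mul_self k hr
  rw [lt_abs] at hk ⊢
  rcases hk with hk | hk
  · left
    nlinarith
  · right
    nlinarith

theorem Asymptotic.of_substMap (hθ : Function.Injective θ) {x y : ℤ → A}
    (h : Asymptotic (_root_.substMap θ x) (_root_.substMap θ y)) : Asymptotic x y := by
  obtain ⟨M, hM⟩ := h
  have hr := natCast_pos_of_neZero r
  -- The same window serves: the block coming from place `n` lies no closer to `0` than `n` does, on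
  -- either side.
  refine ⟨M, fun n hn => eq_of_substMap_block_eq hθ fun k hk hkr => hM k ?_⟩
  rw [lt_abs] at hn ⊢
  rcases hn with hn | hn
  · left
    nlinarith
  · right
    nlinarith

theorem Asymptotic.iterate_substMap (p : ℕ) {x y : ℤ → A} (h : Asymptotic x y) :
    Asymptotic ((_root_.substMap θ)^[p] x) ((_root_.substMap θ)^[p] y) := by
  induction p with
  | zero => exact h
  | succ p ih =>
    rw [Function.iterate_succ_apply', Function.iterate_succ_apply']
    exact ih.substMap

theorem Asymptotic.of_iterate_substMap (hθ : Function.Injective θ) (p : ℕ) {x y : ℤ → A}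
    (h : Asymptotic ((_root_.substMap θ)^[p] x) ((_root_.substMap θ)^[p] y)) :
    Asymptotic x y := by
  induction p with
  | zero => exact h
  | succ p ih =>
    rw [Function.iterate_succ_apply', Function.iterate_succ_apply'] at h
    exact ih (h.of_substMap hθ)

/-- Every letter occurs in a periodic point of a primitive substitution. -/
theorem IsPrimitiveSubst.exists_apply_eq (hθ : IsPrimitiveSubst θ) {p : ℕ} (hp : 0 < p)
    {x : ℤ → A} (hx : (substMap θ)^[p] x = x) (a : A) : ∃ i, x i = a := by
  obtain ⟨K, -, hK⟩ := hθ
  have hreach : ∀ z : ℤ → A, ∃ i, (substMap θ)^[K] z i = a := by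
    intro z
    obtain ⟨w, hw0, hwK, hw⟩ := hK (z 0) a
    have : ∀ n ≤ K, ∃ i, (substMap θ)^[n] z i = w n := by
      intro n
      induction n with
      | zero => exact fun _ => ⟨0, hw0.symm⟩
      | succ n ih =>
        intro hn
        obtain ⟨i, hi⟩ := ih (by omega)
        obtain ⟨j, hj⟩ := hw n (by omega)
        refine ⟨i * r + (j : ℕ), ?_⟩
        rw [Function.iterate_succ_apply', substMap_apply, hi, hj]
    obtain ⟨i, hi⟩ := this K le_rfl
    exact ⟨i, hi.trans hwK⟩
  -- Applying `K` more steps to this point gives the `p * K`-th iterate of `x`, which is `x`.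
  obtain ⟨i, hi⟩ := hreach ((substMap θ)^[p * K - K] x)
  refine ⟨i, ?_⟩
  rw [← Function.iterate_add_apply, Nat.add_sub_cancel' (Nat.le_mul_of_pos_left K hp),
    Function.iterate_mul, Function.iterate_fixed hx] at hi
  exact hi

theorem iterate_substMap_mem_orbitClosure [TopologicalSpace A] [DiscreteTopology A] {p : ℕ}
    {x y : ℤ → A} (hx : (substMap θ)^[p] x = x) (hy : y ∈ orbitClosure x) :
    (substMap θ)^[p] y ∈ orbitClosure x := by
  refine map_mem_closure ((continuous_substMap θ).iterate p) hy ?_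
  rintro _ ⟨n, rfl⟩
  refine ⟨(r : ℤ) ^ p * n, ?_⟩
  have := iterate_substMap_shiftBy θ p n x
  rw [hx] at this
  exact this.symm

end Substitution

/-! ### Arithmetic of 2-adic valuations. -/

/-- The parity of the 2-adic valuation. -/
def dyadicParity (w : ℤ) : Fin 2 := if Odd (padicValInt 2 w) then 1 else 0

theorem padicValInt_two_pow_mul_odd (N : ℕ) {u : ℤ} (hu : Odd u) :
    padicValInt 2 (2 ^ N * u) = N := by
  have hu0 : u ≠ 0 := by rintro rfl; simp at hu
  have h2 : ¬ ((2 : ℕ) : ℤ) ∣ u := by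
    rw [Nat.cast_ofNat, ← even_iff_two_dvd, Int.not_even_iff_odd]
    exact hu
  have hpow : padicValInt 2 (2 ^ N) = N := by
    unfold padicValInt
    simp [Int.natAbs_pow]
  rw [padicValInt.mul (by positivity) hu0, padicValInt.eq_zero_of_not_dvd h2, hpow, add_zero]

theorem dyadicParity_two_pow_mul_odd (N : ℕ) {u : ℤ} (hu : Odd u) :
    dyadicParity (2 ^ N * u) = if Odd N then 1 else 0 := by
  rw [dyadicParity, padicValInt_two_pow_mul_odd N hu]

theorem exists_eq_two_pow_mul_odd_int {w : ℤ} (hw : w ≠ 0) :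
    ∃ (k : ℕ) (u : ℤ), Odd u ∧ w = 2 ^ k * u := by
  obtain ⟨k, m, hm, h⟩ := Nat.exists_eq_two_pow_mul_odd (Int.natAbs_ne_zero.mpr hw)
  have hm' : Odd (m : ℤ) := by exact_mod_cast hm
  rcases Int.natAbs_eq w with h' | h'
  · exact ⟨k, m, hm', by rw [h', h]; push_cast; ring⟩
  · exact ⟨k, -m, hm'.neg, by rw [h', h]; push_cast; ring⟩

/-- A number not divisible by `2 ^ N` is `2 ^ j` times an odd number for some `j < N`. -/
theorem exists_lt_eq_two_pow_mul_odd {N : ℕ} {w : ℤ} (hw : ¬ (2 : ℤ) ^ N ∣ w) :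
    ∃ (j : ℕ) (u : ℤ), j < N ∧ Odd u ∧ w = 2 ^ j * u := by
  obtain ⟨j, u, hu, rfl⟩ := exists_eq_two_pow_mul_odd_int (w := w) (by rintro rfl; simp at hw)
  refine ⟨j, u, ?_, hu, rfl⟩
  by_contra hj
  exact hw ((pow_dvd_pow 2 (not_lt.mp hj)).mul_right u)

theorem dyadicParity_congr {N : ℕ} {w w' : ℤ} (hw : ¬ (2 : ℤ) ^ N ∣ w)
    (h : (2 : ℤ) ^ N ∣ w' - w) : dyadicParity w' = dyadicParity w := by
  obtain ⟨j, u, hj, hu, rfl⟩ := exists_lt_eq_two_pow_mul_odd hw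
  obtain ⟨d, hd⟩ := h
  obtain ⟨i, rfl⟩ := Nat.exists_eq_add_of_lt hj
  have : w' = 2 ^ j * (u + 2 * (2 ^ i * d)) := by
    rw [sub_eq_iff_eq_add.mp hd]
    ring
  rw [this, dyadicParity_two_pow_mul_odd _ hu,
    dyadicParity_two_pow_mul_odd _ (hu.add_even (even_two_mul _))]

theorem not_two_pow_dvd_two_pow_mul_odd {N j : ℕ} (hj : j < N) {u : ℤ} (hu : Odd u) :
    ¬ (2 : ℤ) ^ N ∣ 2 ^ j * u := by
  obtain ⟨i, rfl⟩ := Nat.exists_eq_add_of_lt hj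
  rintro ⟨d, hd⟩
  have : u = 2 * (2 ^ i * d) := by
    have h2 : (2 : ℤ) ^ j ≠ 0 := by positivity
    apply mul_left_cancel₀ h2
    rw [hd]
    ring
  rw [this] at hu
  exact (Int.not_odd_iff_even.mpr (even_two_mul _)) hu

theorem not_two_pow_dvd_of_abs_lt {N : ℕ} {w : ℤ} (hw : w ≠ 0) (h : |w| < 2 ^ N) :
    ¬ (2 : ℤ) ^ N ∣ w := fun hd =>
  hw (Int.eq_zero_of_abs_lt_dvd hd h)

theorem toeplitzSeq_eq_dyadicParity (n : ℤ) : toeplitzSeq n = dyadicParity (n + 1) := rfl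

/-! ### Points with a single hole. -/

/-- The sequence with entries `dyadicParity (n - s)` away from the place `s`, and `b` there. -/
def holePoint (b : Fin 2) (s : ℤ) : ℤ → Fin 2 := fun n => if n = s then b else dyadicParity (n - s)

theorem holePoint_self (b : Fin 2) (s : ℤ) : holePoint b s s = b := if_pos rfl

theorem holePoint_of_ne (b : Fin 2) {s n : ℤ} (h : n ≠ s) :
    holePoint b s n = dyadicParity (n - s) := if_neg h

theorem shiftBy_holePoint (j : ℤ) (b : Fin 2) (s : ℤ) :
    shiftBy j (holePoint b s) = holePoint b (s - j) := by
  funext n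
  simp only [shiftBy, holePoint]
  have : n + j - s = n - (s - j) := by ring
  rw [this]
  congr 1
  exact propext ⟨fun h => by omega, fun h => by omega⟩

theorem toeplitzSeq_eq_holePoint : toeplitzSeq = holePoint 0 (-1) := by
  funext n
  by_cases hn : n = -1
  · subst hn
    simp [holePoint, toeplitzSeq]
  · rw [holePoint_of_ne 0 hn, toeplitzSeq_eq_dyadicParity, sub_neg_eq_add]

/-- A closed set invariant under the shift by `2 ^ k * m`, with `m` odd, that contains a point
with a hole at `s` contains both points with a hole at `s - 2 ^ k`. -/
theorem holePoint_sub_mem {Z : Set (ℤ → Fin 2)} (hZ : IsClosed Z) {k : ℕ} {m : ℤ} (hm : Odd m)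
    (hinv : ∀ j : ℤ, ∀ z ∈ Z, shiftBy (2 ^ k * m * j) z ∈ Z) {a : Fin 2} {s : ℤ}
    (ha : holePoint a s ∈ Z) (b : Fin 2) : holePoint b (s - 2 ^ k) ∈ Z := by
  refine mem_of_forall_cylinder hZ fun M => ?_
  -- The old hole will be sent to distance `2 ^ (k + L)` times an odd number from `s - 2 ^ k`. The
  -- parity of `k + L` then appears at `s - 2 ^ k`, and large `L` leaves the rest of the window
  -- unaffected.
  obtain ⟨L, hL, hb⟩ : ∃ L : ℕ, M + (s - 2 ^ k).natAbs ≤ L ∧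
      (if Odd (k + L) then (1 : Fin 2) else 0) = b := by
    have key : ∀ B : ℕ, ∃ L : ℕ, B ≤ L ∧ (if Odd (k + L) then (1 : Fin 2) else 0) = b := by
      intro B
      by_cases hB : (if Odd (k + B) then (1 : Fin 2) else 0) = b
      · exact ⟨B, le_rfl, hB⟩
      · refine ⟨B + 1, by omega, ?_⟩
        simp only [← add_assoc, Nat.odd_add_one]
        by_cases ho : Odd (k + B)
        · simp only [ho, if_true, not_true, if_false] at hB ⊢
          omega
        · simp only [ho, if_false, not_false_eq_true, if_true] at hB ⊢
          omega
    exact key _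
  -- Inverting `m` modulo `2 ^ (L + 1)`, rather than `2 ^ L`, is what controls the parity of `u`.
  obtain ⟨j, u, hu, hj⟩ : ∃ j u : ℤ, Odd u ∧ m * j = 1 + 2 ^ L * u := by
    have hco : IsCoprime m ((2 : ℤ) ^ (L + 1)) := by
      apply IsCoprime.pow_right
      obtain ⟨d, rfl⟩ := hm
      exact ⟨1, -d, by ring⟩
    obtain ⟨c, d, hcd⟩ := hco
    refine ⟨c * (1 + 2 ^ L), 1 + 2 * (-d * (1 + 2 ^ L)), odd_one.add_even (even_two_mul _), ?_⟩
    have : m * (c * (1 + 2 ^ L)) = (c * m) * (1 + 2 ^ L) := by ring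
    rw [this, eq_sub_of_add_eq hcd]
    ring
  refine ⟨_, hinv j _ ha, fun n hn => ?_⟩
  rw [shiftBy_holePoint]
  have hdiff : n - (s - 2 ^ k * m * j) = (n - (s - 2 ^ k)) + 2 ^ (k + L) * u := by
    rw [mul_assoc, hj]
    ring
  by_cases hns : n = s - 2 ^ k
  · rw [hns, sub_self, zero_add, ← hns] at hdiff
    have hne : n ≠ s - 2 ^ k * m * j := by
      intro h
      rw [sub_eq_zero.mpr h] at hdiff
      exact not_two_pow_dvd_two_pow_mul_odd (Nat.lt_succ_self (k + L)) hu (hdiff ▸ dvd_zero _)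
    rw [holePoint_of_ne _ hne, hdiff, dyadicParity_two_pow_mul_odd _ hu, hb, hns, holePoint_self]
  · have hnd : ¬ (2 : ℤ) ^ (k + L) ∣ n - (s - 2 ^ k) := by
      apply not_two_pow_dvd_of_abs_lt (sub_ne_zero.mpr hns)
      have h1 : ((k + L : ℕ) : ℤ) < 2 ^ (k + L) := by exact_mod_cast Nat.lt_two_pow_self
      have h2 := abs_sub n (s - 2 ^ k)
      have h3 : ((s - 2 ^ k).natAbs : ℤ) = |s - 2 ^ k| := Int.natCast_natAbs _
      push_cast at h1
      zify at hL
      omega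
    have hne : n ≠ s - 2 ^ k * m * j := by
      intro h
      rw [sub_eq_zero.mpr h] at hdiff
      exact hnd ⟨-u, by linarith⟩
    rw [holePoint_of_ne _ hne, holePoint_of_ne _ hns, hdiff]
    exact dyadicParity_congr hnd ⟨u, by ring⟩

theorem isClosed_toeplitzSet : IsClosed toeplitzSet := isClosed_closure

theorem shiftBy_mem_toeplitzSet (n : ℤ) (x : ℤ → Fin 2) (hx : x ∈ toeplitzSet) :
    shiftBy n x ∈ toeplitzSet :=
  shiftBy_mem_orbitClosure n hx

theorem holePoint_mem_toeplitzSet (b : Fin 2) (s : ℤ) : holePoint b s ∈ toeplitzSet := by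
  have h0 : holePoint 0 (-1) ∈ toeplitzSet := by
    rw [← toeplitzSeq_eq_holePoint]
    exact self_mem_orbitClosure _
  have h1 := holePoint_sub_mem isClosed_toeplitzSet (k := 0) odd_one
    (fun j z hz => shiftBy_mem_toeplitzSet _ z hz) h0 b
  have h2 := shiftBy_mem_toeplitzSet (-2 - s) _ h1
  rw [shiftBy_holePoint] at h2
  convert h2 using 2
  norm_num

/-! ### Periodic skeletons and asymptotic pairs of the Toeplitz set. -/

/-- The `2 ^ N`-periodic skeleton with holes at `c + 2 ^ N ℤ`: the entries off the holes are
prescribed, and of two consecutive hole entries one is the parity of `N`. -/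
def HasSkeleton (N : ℕ) (c : ℤ) (x : ℤ → Fin 2) : Prop :=
  (∀ n : ℤ, ¬ (2 : ℤ) ^ N ∣ n - c → x n = dyadicParity (n - c)) ∧
  ∀ n : ℤ, (2 : ℤ) ^ N ∣ n - c →
    x n = dyadicParity (2 ^ N) ∨ x (n + 2 ^ N) = dyadicParity (2 ^ N)

theorem isClosed_setOf_hasSkeleton (N : ℕ) (c : ℤ) : IsClosed {x | HasSkeleton N c x} := by
  have heq : ∀ (n : ℤ) (v : Fin 2), IsClosed {x : ℤ → Fin 2 | x n = v} := fun n v =>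
    isClosed_eq (continuous_apply n) continuous_const
  refine IsClosed.inter (s₁ := {x | ∀ n : ℤ, _}) (s₂ := {x | ∀ n : ℤ, _}) ?_ ?_
  · simp only [Set.ofPred_forall]
    exact isClosed_iInter fun n => isClosed_iInter fun _ => heq _ _
  · simp only [Set.ofPred_forall]
    exact isClosed_iInter fun n => isClosed_iInter fun _ => (heq _ _).union (heq _ _)

theorem hasSkeleton_shiftBy_toeplitzSeq (N : ℕ) {c j : ℤ} (hc : (2 : ℤ) ^ N ∣ c + j + 1) :
    HasSkeleton N c (shiftBy j toeplitzSeq) := by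
  constructor
  · intro n hn
    rw [shiftBy, toeplitzSeq_eq_dyadicParity]
    exact dyadicParity_congr hn ((by ring : c + j + 1 = n + j + 1 - (n - c)) ▸ hc)
  · intro n hn
    obtain ⟨d, hd⟩ : (2 : ℤ) ^ N ∣ n + j + 1 :=
      (by ring : n - c + (c + j + 1) = n + j + 1) ▸ dvd_add hn hc
    simp only [shiftBy, toeplitzSeq_eq_dyadicParity]
    have h2 : n + 2 ^ N + j + 1 = 2 ^ N * (d + 1) := by linear_combination hd
    rw [h2, hd]
    have hone := dyadicParity_two_pow_mul_odd N odd_one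
    rw [mul_one] at hone
    rw [hone]
    -- Consecutive holes sit at consecutive multiples of `2 ^ N`, and one of the two multipliers is
    -- odd.
    rcases Int.even_or_odd d with h | h
    · right
      exact dyadicParity_two_pow_mul_odd N (h.add_odd odd_one)
    · left
      exact dyadicParity_two_pow_mul_odd N h

/-- Only finitely many residues of `c` modulo `2 ^ N` matter, so the skeleton passes from the orbit
to its closure. -/
theorem exists_hasSkeleton {x : ℤ → Fin 2} (hx : x ∈ toeplitzSet) (N : ℕ) :
    ∃ c, HasSkeleton N c x := by
  have hcl : IsClosed (⋃ i ∈ Finset.range (2 ^ N), {x | HasSkeleton N (i : ℤ) x}) :=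
    isClosed_biUnion_finset fun i _ => isClosed_setOf_hasSkeleton N i
  have hsub : toeplitzSet ⊆ ⋃ i ∈ Finset.range (2 ^ N), {x | HasSkeleton N (i : ℤ) x} := by
    refine closure_minimal ?_ hcl
    rintro _ ⟨j, rfl⟩
    have hpos : (0 : ℤ) < 2 ^ N := by positivity
    have h0 := Int.emod_nonneg (-(j + 1)) hpos.ne'
    have h1 := Int.emod_lt_of_pos (-(j + 1)) hpos
    refine Set.mem_iUnion₂.mpr ⟨((-(j + 1)) % 2 ^ N).toNat, ?_, ?_⟩
    · rw [Finset.mem_range]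
      zify
      rw [Int.toNat_of_nonneg h0]
      exact h1
    · refine hasSkeleton_shiftBy_toeplitzSeq N ?_
      rw [Int.toNat_of_nonneg h0]
      refine ⟨-((-(j + 1)) / 2 ^ N), ?_⟩
      have := Int.emod_add_mul_ediv (-(j + 1)) (2 ^ N)
      linear_combination this
  obtain ⟨i, -, hi⟩ := Set.mem_iUnion₂.mp (hsub hx)
  exact ⟨i, hi⟩

/-- If `c' - c` had valuation `j < N`, places arbitrarily far out would have valuation `j + 1`
relative to `c'` but `j` relative to `c`, so opposite parities. The level `N + 1` makes both entries
prescribed. -/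
theorem HasSkeleton.hole_congr {N : ℕ} {c c' : ℤ} {x x' : ℤ → Fin 2}
    (hx : HasSkeleton (N + 1) c x) (hx' : HasSkeleton (N + 1) c' x') (h : Asymptotic x x') :
    (2 : ℤ) ^ N ∣ c' - c := by
  by_contra hnd
  obtain ⟨j, u, hj, hu, hju⟩ := exists_lt_eq_two_pow_mul_odd hnd
  obtain ⟨M, hM⟩ := h
  let i : ℤ := M + |c'|
  have hodd : Odd (1 + 2 * i) := odd_one.add_even (even_two_mul _)
  have hodd' : Odd (2 * (1 + 2 * i) + u) := (even_two_mul _).add_odd hu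
  let n : ℤ := c' + 2 ^ (j + 1) * (1 + 2 * i)
  have h1 : n - c' = 2 ^ (j + 1) * (1 + 2 * i) := by simp only [n]; ring
  have h2 : n - c = 2 ^ j * (2 * (1 + 2 * i) + u) := by
    simp only [n]
    linear_combination hju
  have hn : (M : ℤ) < |n| := by
    rw [lt_abs]
    left
    have hp : (1 : ℤ) ≤ 2 ^ (j + 1) := one_le_pow₀ (by norm_num)
    have h3 := neg_abs_le c'
    have h4 := abs_nonneg c'
    have h5 : 0 ≤ 1 + 2 * i := by simp only [i]; positivity
    have h6 : 1 + 2 * i ≤ 2 ^ (j + 1) * (1 + 2 * i) := le_mul_of_one_le_left h5 hp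
    simp only [n]
    simp only [i] at h6 ⊢
    linarith
  have e := hM n hn
  rw [hx.1 n (h2 ▸ not_two_pow_dvd_two_pow_mul_odd (by omega) hodd'),
    hx'.1 n (h1 ▸ not_two_pow_dvd_two_pow_mul_odd (by omega) hodd), h1, h2,
    dyadicParity_two_pow_mul_odd _ hodd, dyadicParity_two_pow_mul_odd _ hodd'] at e
  simp only [Nat.odd_add_one] at e
  by_cases ho : Odd j <;> simp [ho] at e

/-- Distinct asymptotic points of the Toeplitz minimal set have a common single hole. -/
theorem exists_eq_holePoint {x x' : ℤ → Fin 2} (hx : x ∈ toeplitzSet) (hx' : x' ∈ toeplitzSet)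
    (h : Asymptotic x x') (hne : x ≠ x') :
    ∃ s, x = holePoint (x s) s ∧ x' = holePoint (x' s) s := by
  obtain ⟨s, hs⟩ := Function.ne_iff.mp hne
  have key : ∀ n, n ≠ s → x n = dyadicParity (n - s) ∧ x' n = dyadicParity (n - s) := by
    intro n hn
    let N := (n - s).natAbs
    have hnd : ¬ (2 : ℤ) ^ N ∣ n - s := by
      apply not_two_pow_dvd_of_abs_lt (sub_ne_zero.mpr hn)
      rw [Int.abs_eq_natAbs]
      exact_mod_cast Nat.lt_two_pow_self
    obtain ⟨c, hc⟩ := exists_hasSkeleton hx (N + 1)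
    obtain ⟨c', hc'⟩ := exists_hasSkeleton hx' (N + 1)
    have hcc := hc.hole_congr hc' h
    have hlift : ∀ w : ℤ, ¬ (2 : ℤ) ^ N ∣ w → ¬ (2 : ℤ) ^ (N + 1) ∣ w := fun w hw hd =>
      hw ((pow_dvd_pow 2 (Nat.le_succ N)).trans hd)
    -- Off the common holes modulo `2 ^ N` the two points agree, and they differ at `s`.
    have hsc : (2 : ℤ) ^ N ∣ s - c := by
      by_contra hd
      have hd' : ¬ (2 : ℤ) ^ N ∣ s - c' := by
        intro h'
        exact hd ((by ring : s - c' + (c' - c) = s - c) ▸ dvd_add h' hcc)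
      apply hs
      rw [hc.1 s (hlift _ hd), hc'.1 s (hlift _ hd')]
      exact dyadicParity_congr hd' ((by ring : c' - c = s - c - (s - c')) ▸ hcc)
    have hsc' : (2 : ℤ) ^ N ∣ s - c' :=
      (by ring : s - c - (c' - c) = s - c') ▸ dvd_sub hsc hcc
    have step : ∀ (z : ℤ → Fin 2) (d : ℤ), HasSkeleton (N + 1) d z → (2 : ℤ) ^ N ∣ s - d →
        z n = dyadicParity (n - s) := by
      intro z d hz hd
      have hnd' : ¬ (2 : ℤ) ^ N ∣ n - d := by
        intro h'
        exact hnd ((by ring : n - d - (s - d) = n - s) ▸ dvd_sub h' hd)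
      rw [hz.1 n (hlift _ hnd')]
      exact dyadicParity_congr hnd ((by ring : s - d = n - d - (n - s)) ▸ hd)
    exact ⟨step x c hc hsc, step x' c' hc' hsc'⟩
  refine ⟨s, funext fun n => ?_, funext fun n => ?_⟩
  all_goals
    by_cases hn : n = s
    · rw [hn, holePoint_self]
    · rw [holePoint_of_ne _ hn]
      first | exact (key n hn).1 | exact (key n hn).2

theorem asymptotic_holePoint (a b : Fin 2) (s : ℤ) :
    Asymptotic (holePoint a s) (holePoint b s) := by
  refine ⟨s.natAbs, fun k hk => ?_⟩
  have : k ≠ s := by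
    rintro rfl
    simp at hk
  rw [holePoint_of_ne _ this, holePoint_of_ne _ this]

/-! ### Substitution sets conjugate to the Toeplitz set. -/

section Conjugate

variable {A : Type*} [TopologicalSpace A] {r : ℕ} [NeZero r]
  {θ : A → Fin r → A} {x : ℤ → A} {p R : ℕ} {f : (ℤ → A) → ℤ → Fin 2} {g : (ℤ → Fin 2) → ℤ → A}

/-- If the orbit closure of a fixed point of `θ ^ p` is conjugate to the Toeplitz minimal set,
then `r ^ p` divides a power of 2. -/
theorem exists_pow_dvd_two_pow [DiscreteTopology A] [Finite A]
    (hθ : Function.Injective θ)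
    (hx : (substMap θ)^[p] x = x) (H : BlockConjugacy (orbitClosure x) toeplitzSet f g R) :
    ∃ k : ℕ, (r : ℤ) ^ p ∣ 2 ^ k := by
  set Θ := (substMap θ)^[p] with hΘ
  have hΘY : ∀ y ∈ orbitClosure x, Θ y ∈ orbitClosure x := fun y hy =>
    iterate_substMap_mem_orbitClosure hx hy
  have hΘinj : Function.Injective Θ := (substMap_injective hθ).iterate p
  have hfΘ : ∀ (j : ℤ), ∀ y ∈ orbitClosure x,
      f (Θ (shiftBy j y)) = shiftBy ((r : ℤ) ^ p * j) (f (Θ y)) := fun j y hy => by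
    rw [hΘ, iterate_substMap_shiftBy, H.equivariant _ _ (hΘY y hy)]
  have finj : ∀ y ∈ orbitClosure x, ∀ z ∈ orbitClosure x, f y = f z → y = z :=
    fun y hy z hz h => by rw [← H.left_inv y hy, h, H.left_inv z hz]
  let y : Fin 2 → ℤ → A := fun b => g (holePoint b 0)
  have hyY : ∀ b, y b ∈ orbitClosure x := fun b => H.mapsTo_inv _ (holePoint_mem_toeplitzSet b 0)
  have hyne : y 0 ≠ y 1 := by
    intro h
    have h1 := congrArg f h
    rw [H.right_inv _ (holePoint_mem_toeplitzSet 0 0),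
      H.right_inv _ (holePoint_mem_toeplitzSet 1 0)] at h1
    have h2 := congrFun h1 0
    rw [holePoint_self, holePoint_self] at h2
    exact absurd h2 (by decide)
  have hyas : Asymptotic (y 0) (y 1) :=
    (asymptotic_holePoint 0 1 0).map_local H.local_inv (holePoint_mem_toeplitzSet 0 0)
      (holePoint_mem_toeplitzSet 1 0)
  obtain ⟨s, hs0, hs1⟩ := exists_eq_holePoint (H.mapsTo _ (hΘY _ (hyY 0)))
    (H.mapsTo _ (hΘY _ (hyY 1)))
    ((hyas.iterate_substMap p).map_local H.local_code (hΘY _ (hyY 0)) (hΘY _ (hyY 1)))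
    (fun h => hyne (hΘinj (finj _ (hΘY _ (hyY 0)) _ (hΘY _ (hyY 1)) h)))
  have hs : ∀ b, f (Θ (y b)) = holePoint (f (Θ (y b)) s) s :=
    Fin.forall_fin_two.mpr ⟨hs0, hs1⟩
  have hr := natCast_pos_of_neZero r
  obtain ⟨k, m, hm, hkm⟩ :=
    exists_eq_two_pow_mul_odd_int (w := (r : ℤ) ^ p) (by positivity)
  have hZ : IsClosed ((fun y => f (Θ y)) '' orbitClosure x) := by
    refine IsCompact.isClosed (IsCompact.image_of_continuousOn isClosed_closure.isCompact ?_)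
    exact H.continuousOn.comp ((continuous_substMap θ).iterate p).continuousOn hΘY
  have hmem : ∀ b, holePoint b (s - 2 ^ k) ∈ (fun y => f (Θ y)) '' orbitClosure x := by
    refine holePoint_sub_mem hZ hm ?_ (a := f (Θ (y 0)) s) ⟨y 0, hyY 0, hs 0⟩
    rintro j _ ⟨z, hz, rfl⟩
    refine ⟨shiftBy j z, shiftBy_mem_orbitClosure j hz, ?_⟩
    rw [← hkm]
    exact hfΘ j z hz
  choose w hwY hw using hmem
  simp only at hw
  have hwne : w 0 ≠ w 1 := by
    intro h
    have h1 := congrFun ((hw 0).symm.trans ((congrArg (fun z => f (Θ z)) h).trans (hw 1)))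
      (s - 2 ^ k)
    rw [holePoint_self, holePoint_self] at h1
    exact absurd h1 (by decide)
  have hwas : Asymptotic (w 0) (w 1) := by
    apply Asymptotic.of_iterate_substMap hθ p
    change Asymptotic (Θ (w 0)) (Θ (w 1))
    rw [← H.left_inv _ (hΘY _ (hwY 0)), ← H.left_inv _ (hΘY _ (hwY 1)), hw 0, hw 1]
    exact (asymptotic_holePoint 0 1 _).map_local H.local_inv (holePoint_mem_toeplitzSet _ _)
      (holePoint_mem_toeplitzSet _ _)
  obtain ⟨v, hv0, hv1⟩ := exists_eq_holePoint (H.mapsTo _ (hwY 0)) (H.mapsTo _ (hwY 1))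
    (hwas.map_local H.local_code (hwY 0) (hwY 1))
    (fun h => hwne (finj _ (hwY 0) _ (hwY 1) h))
  have hv : ∀ b, f (w b) = holePoint (f (w b) v) v := Fin.forall_fin_two.mpr ⟨hv0, hv1⟩
  -- `w b` is a shift by `-v` of a member of the basic pair, and `Θ` multiplies shifts by `r ^ p`.
  have hhole : ∀ b, ∃ a, holePoint b (s - 2 ^ k) = holePoint a (s + (r : ℤ) ^ p * v) := by
    intro b
    have h1 : w b = shiftBy (-v) (y (f (w b) v)) := by
      rw [← H.equivariant_inv _ _ (holePoint_mem_toeplitzSet _ _), shiftBy_holePoint, zero_sub,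
        neg_neg, ← hv b, H.left_inv _ (hwY b)]
    refine ⟨f (Θ (y (f (w b) v))) s, ?_⟩
    rw [← hw b, h1, hfΘ _ _ (hyY _), ← h1, hs, shiftBy_holePoint, holePoint_self]
    congr 1
    ring
  refine ⟨k, -v, ?_⟩
  -- Were the two places distinct, the entry at `s - 2 ^ k` would be prescribed, yet it takes both
  -- values `b`.
  by_contra hk
  have hplace : s - 2 ^ k ≠ s + (r : ℤ) ^ p * v := fun h => hk (by linarith)
  have hval : ∀ b, b = dyadicParity (s - 2 ^ k - (s + (r : ℤ) ^ p * v)) := by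
    intro b
    obtain ⟨a, ha⟩ := hhole b
    have := congrFun ha (s - 2 ^ k)
    rwa [holePoint_self, holePoint_of_ne _ hplace] at this
  exact absurd ((hval 0).trans (hval 1).symm) (by decide)

/-- If `θ ^ p` has length `2 ^ N ≥ 2 R` and fixes `x`, each letter of `x` is determined by two
consecutive hole entries of the image of `x` under a conjugacy of radius `R`. -/
theorem card_le_three [Fintype A] (hθ : Function.Injective θ) {N : ℕ}
    (hx : (substMap θ)^[p] x = x) (hrp : (r : ℤ) ^ p = 2 ^ N) (hN : 2 * (R : ℤ) ≤ 2 ^ N)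
    (hocc : ∀ a, ∃ i, x i = a) (H : BlockConjugacy (orbitClosure x) toeplitzSet f g R) :
    Fintype.card A ≤ 3 := by
  have hxY := self_mem_orbitClosure x
  have huT := H.mapsTo x hxY
  obtain ⟨c, hc⟩ := exists_hasSkeleton huT N
  have hq : (0 : ℤ) < 2 ^ N := by positivity
  -- `e` is the first hole in the window from `-R` up to `2 ^ N + R`; by `hN`, only `e + 2 ^ N` can
  -- be another.
  obtain ⟨e, he1, he2, hce⟩ : ∃ e : ℤ, -R ≤ e ∧ e < 2 ^ N - R ∧ (2 : ℤ) ^ N ∣ e - c := by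
    refine ⟨(c + R) % 2 ^ N - R, ?_, ?_, -((c + R) / 2 ^ N), ?_⟩
    · have := Int.emod_nonneg (c + R) hq.ne'
      linarith
    · have := Int.emod_lt_of_pos (c + R) hq
      linarith
    · linear_combination Int.emod_add_mul_ediv (c + R) (2 ^ N)
  choose i hi using hocc
  have hpair : ∀ a, (f x (e + 2 ^ N * i a), f x (e + 2 ^ N + 2 ^ N * i a)) ≠
      (1 - dyadicParity (2 ^ N), 1 - dyadicParity (2 ^ N)) := by
    intro a h
    have h1 := hc.2 (e + 2 ^ N * i a)
      ((by ring : e - c + 2 ^ N * i a = e + 2 ^ N * i a - c) ▸ dvd_add hce (dvd_mul_right _ _))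
    rw [add_right_comm, (Prod.mk.inj h).1, (Prod.mk.inj h).2] at h1
    revert h1
    generalize dyadicParity (2 ^ N) = v
    revert v
    decide
  let F : A → {b : Fin 2 × Fin 2 // b ≠ (1 - dyadicParity (2 ^ N), 1 - dyadicParity (2 ^ N))} :=
    fun a => ⟨_, hpair a⟩
  have hF : Function.Injective F := by
    intro a b hab
    have h1 := (Prod.mk.inj (congrArg Subtype.val hab)).1
    have h2 := (Prod.mk.inj (congrArg Subtype.val hab)).2
    have hdvd : ∀ l j : ℤ, (2 : ℤ) ^ N ∣ l + 2 ^ N * j - c ↔ (2 : ℤ) ^ N ∣ l - e := by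
      intro l j
      have h3 : l + 2 ^ N * j - c = (l - e) + ((e - c) + 2 ^ N * j) := by ring
      rw [h3]
      exact dvd_add_left (dvd_add hce (dvd_mul_right _ _))
    have hwin : ∀ l : ℤ, -R ≤ l → l < 2 ^ N + R →
        f x (l + 2 ^ N * i a) = f x (l + 2 ^ N * i b) := by
      intro l hl hl'
      by_cases hd : (2 : ℤ) ^ N ∣ l - e
      · obtain ⟨d, hd⟩ := hd
        have hd0 : -1 < d := by
          by_contra hneg
          nlinarith
        have hd1 : d < 2 := by
          by_contra hneg
          nlinarith
        obtain rfl | rfl : d = 0 ∨ d = 1 := by omega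
        · obtain rfl : l = e := by linarith
          exact h1
        · obtain rfl : l = e + 2 ^ N := by linarith
          exact h2
      · have ha := (hdvd l (i a)).not.mpr hd
        have hb := (hdvd l (i b)).not.mpr hd
        rw [hc.1 _ ha, hc.1 _ hb]
        exact dyadicParity_congr hb ⟨i a - i b, by ring⟩
    have hshift : ∀ j : ℤ, (substMap θ)^[p] (shiftBy j x) = shiftBy (2 ^ N * j) x := by
      intro j
      rw [iterate_substMap_shiftBy, hx, hrp]
    have hcode : ∀ j : ℤ, shiftBy j x = g (shiftBy j (f x)) := by
      intro j
      rw [H.equivariant_inv j _ huT, H.left_inv x hxY]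
    have hblock : shiftBy (i a) x 0 = shiftBy (i b) x 0 := by
      refine eq_of_iterate_substMap_block_eq hθ p fun k hk hkq => ?_
      rw [hrp] at hkq
      rw [hshift, hshift, hcode, hcode]
      refine H.local_inv _ (shiftBy_mem_toeplitzSet _ _ huT) _ (shiftBy_mem_toeplitzSet _ _ huT) k
        fun l hl => ?_
      rw [abs_le] at hl
      exact hwin l (by linarith) (by linarith)
    simpa [shiftBy, hi] using hblock
  refine (Fintype.card_le_of_injective F hF).trans (le_of_eq ?_)
  generalize 1 - dyadicParity (2 ^ N) = v
  revert v
  decide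

end Conjugate

theorem mainTheorem4 {A : Type*} [Fintype A] [Nontrivial A] [TopologicalSpace A]
    [DiscreteTopology A] {r : ℕ} [NeZero r] (hr : 2 ≤ r) (θ : A → Fin r → A)
    (hinj : Function.Injective θ) (hprim : IsPrimitiveSubst θ)
    (Y : Set (ℤ → A)) (hY : IsSubstMinimalSet θ Y) (hconj : TopConjugate Y toeplitzSet) :
    (∃ k : ℕ, r = 2 ^ k) ∧ Fintype.card A ≤ 3 := by
  obtain ⟨x, ⟨p, hp, hx⟩, rfl, -⟩ := hY
  obtain ⟨f, g, R, H⟩ := hconj.exists_blockConjugacy isClosed_closure isClosed_toeplitzSet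
    (fun n _ hy => shiftBy_mem_orbitClosure n hy) shiftBy_mem_toeplitzSet
  have hx' : (substMap θ)^[p] x = x := hx
  have hpow : ∃ k : ℕ, r = 2 ^ k := by
    obtain ⟨k, hk⟩ := exists_pow_dvd_two_pow hinj hx' H
    have hk' : r ^ p ∣ 2 ^ k := by exact_mod_cast hk
    obtain ⟨l, -, hl⟩ := (Nat.dvd_prime_pow Nat.prime_two).mp ((dvd_pow_self r hp.ne').trans hk')
    exact ⟨l, hl⟩
  refine ⟨hpow, ?_⟩
  obtain ⟨k, hk⟩ := hpow
  have hk0 : k ≠ 0 := by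
    rintro rfl
    omega
  -- The multiple `2 * R` of the period makes `2 ^ N` at least `2 * R`, as `k` and `p` are positive.
  have hx'' : (substMap θ)^[p * (2 * R)] x = x := by
    rw [Function.iterate_mul, Function.iterate_fixed hx']
  refine card_le_three hinj (N := k * (p * (2 * R))) hx'' ?_ ?_
    (hprim.exists_apply_eq hp hx') H
  · rw [hk]
    push_cast
    rw [← pow_mul]
  · have h1 : 2 * R ≤ k * (p * (2 * R)) :=
      (Nat.le_mul_of_pos_left _ hp).trans (Nat.le_mul_of_pos_left _ (Nat.pos_of_ne_zero hk0))
    have h2 : 2 * R ≤ 2 ^ (k * (p * (2 * R))) := h1.trans Nat.lt_two_pow_self.le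
    exact_mod_cast h2
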